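/- Let $n\ge 1$ and $s\in(0,1)$. For a bounded open set $\Omega\subset\mathbb{R}^n$ with Lipschitz boundary, let $\mathcal C\Omega:=\mathbb{R}^n\setminus\Omega$, $Q(\Omega):=\mathbb{R}^{2n}\setminus(\mathcal C\Omega)^2$ and, for $t>0$, $\Omega_t:=\{y\in\mathbb{R}^n : \operatorname{dist}(y,\Omega)<t\}$. Let $\mathcal W^s(\Omega)$ be the set of measurable functions $u:\mathbb{R}^n\to\mathbb{R}$ with $u\in W^{s,1}(\Omega)$, that is, $u\in L^1(\Omega)$ and $$\int_\Omega\int_\Omega\frac{|u(x)-u(y)|}{|x-y|^{n+s}}\,dx\,dy<+\infty .$$ A function $u\in\mathcal W^s(\Omega)$ is called an $s$-minimal function in $\Omega$ if $$\iint_{Q(\Omega)}\big(|u(x)-u(y)|-|v(x)-v(y)|\big)\frac{dx\,dy}{|x-y|^{n+s}}\le 0$$ for every $v\in\mathcal W^s(\Omega)$ such that $u=v$ almost everywhere in $\mathcal C\Omega$ (for such $u,v$ the integral converges absolutely, by the fractional Hardy inequality). Theorem (maximum principle). There exists $\Theta=\Theta(n,s)>1$, depending only on $n$ and $s$, such that for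 every bounded open set $\Omega\subset\mathbb{R}^n$ with Lipschitz boundary, denoting $d:=\operatorname{diam}(\Omega)$, every $s$-minimal function $u$ in $\Omega$ satisfies $$\sup_{\Omega}u\le\sup_{\Omega_{\Theta d}\setminus\Omega}u\qquad\text{and}\qquad\inf_{\Omega}u\ge\inf_{\Omega_{\Theta d}\setminus\Omega}u ,$$ where $\sup$ and $\inf$ denote the essential supremum and the essential infimum (with respect to Lebesgue measure), with values in $[-\infty,+\infty]$. -/

import Mathlib

open MeasureTheory Set Filter Topology
open scoped ENNReal NNReal

/-- The open set `Ω` has Lipschitz boundary: near each of its boundary points, up to a rotation,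
`Ω` is the part of space lying strictly above the graph of a Lipschitz function (`e` is the
vertical direction, and the graph is taken over the hyperplane orthogonal to `e`). -/
def HasLipschitzBoundary {n : ℕ} (Ω : Set (EuclideanSpace ℝ (Fin n))) : Prop :=
  ∀ p ∈ frontier Ω, ∃ e : EuclideanSpace ℝ (Fin n), ‖e‖ = 1 ∧
    ∃ (K : ℝ≥0) (g : (Submodule.span ℝ {e})ᗮ → ℝ), LipschitzWith K g ∧
      ∃ r > 0, ∀ x ∈ Metric.ball p r,
        (x ∈ Ω ↔ g ((Submodule.span ℝ {e})ᗮ.orthogonalProjectionOnto x) < inner ℝ e x)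

/-- The Gagliardo seminorm `[u]_{W^{s,1}(Ω)}`, with values in `[0, ∞]`. -/
noncomputable def gagliardoSeminorm {n : ℕ} (s : ℝ) (Ω : Set (EuclideanSpace ℝ (Fin n)))
    (u : EuclideanSpace ℝ (Fin n) → ℝ) : ℝ≥0∞ :=
  ∫⁻ x in Ω, ∫⁻ y in Ω, ENNReal.ofReal (|u x - u y| / ‖x - y‖ ^ ((n : ℝ) + s))

/-- The space `𝒲^s(Ω)` of the (Lebesgue) measurable functions on the whole of `ℝⁿ` whose
restriction to `Ω` belongs to `W^{s,1}(Ω)`. -/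
def fracSobolevSpace {n : ℕ} (s : ℝ) (Ω : Set (EuclideanSpace ℝ (Fin n))) :
    Set (EuclideanSpace ℝ (Fin n) → ℝ) :=
  {u | AEMeasurable u volume ∧ IntegrableOn u Ω volume ∧ gagliardoSeminorm s Ω u < ∞}

/-- The interaction region `Q(Ω) = ℝ²ⁿ \ (𝒞Ω)²`. -/
def interactionRegion {n : ℕ} (Ω : Set (EuclideanSpace ℝ (Fin n))) :
    Set (EuclideanSpace ℝ (Fin n) × EuclideanSpace ℝ (Fin n)) :=
  (Ωᶜ ×ˢ Ωᶜ)ᶜ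

/-- `∫ f dμ ≤ 0` in the sense of Lebesgue, `∫ f⁺ dμ ≤ ∫ f⁻ dμ`. For integrable `f` this is
`∫ f dμ ≤ 0` for the Bochner integral (next lemma); unlike the latter, it does not
replace the integral of a non-integrable function by `0`. -/
def HasNonposIntegral {α : Type*} [MeasurableSpace α] (f : α → ℝ) (μ : Measure α) : Prop :=
  ∫⁻ a, ENNReal.ofReal (f a) ∂μ ≤ ∫⁻ a, ENNReal.ofReal (-f a) ∂μ

theorem hasNonposIntegral_iff {α : Type*} [MeasurableSpace α] {f : α → ℝ} {μ : Measure α}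
    (hf : Integrable f μ) : HasNonposIntegral f μ ↔ ∫ a, f a ∂μ ≤ 0 := by
  have h1 : ∫⁻ a, ENNReal.ofReal (f a) ∂μ ≠ ∞ := hf.lintegral_lt_top.ne
  have h2 : ∫⁻ a, ENNReal.ofReal (-f a) ∂μ ≠ ∞ := hf.neg.lintegral_lt_top.ne
  rw [integral_eq_lintegral_pos_part_sub_lintegral_neg_part hf, sub_nonpos,
    ENNReal.toReal_le_toReal h1 h2, HasNonposIntegral]

/-- `u` is an `s`-minimal function in `Ω`: `u ∈ 𝒲^s(Ω)` and, for every competitor `v ∈ 𝒲^s(Ω)`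
with `u = v` almost everywhere outside `Ω`,
`∬_{Q(Ω)} (|u(x) - u(y)| - |v(x) - v(y)|) / |x - y|^{n+s} dx dy ≤ 0`. -/
def IsSMinimal {n : ℕ} (s : ℝ) (Ω : Set (EuclideanSpace ℝ (Fin n)))
    (u : EuclideanSpace ℝ (Fin n) → ℝ) : Prop :=
  u ∈ fracSobolevSpace s Ω ∧
    ∀ v ∈ fracSobolevSpace s Ω, u =ᵐ[volume.restrict Ωᶜ] v →
      HasNonposIntegral
        (fun z : EuclideanSpace ℝ (Fin n) × EuclideanSpace ℝ (Fin n) =>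
          (|u z.1 - u z.2| - |v z.1 - v z.2|) / ‖z.1 - z.2‖ ^ ((n : ℝ) + s))
        (volume.restrict (interactionRegion Ω))

/-! Let `M` bound `u` on the collar `A = Ω_{Θd} \ Ω`, and replace `u` by `min u M` inside `Ω`. Pairs
in `Ω × Ω` do not increase the energy, a pair `(x, y)` in `Ω × A` saves exactly `(u x - M)⁺`, and a
pair with `y` beyond the collar costs at most `(u x - M)⁺`. Minimality therefore bounds the excess
weighted by the kernel mass of `A` by the excess weighted by the far mass
(`IsSMinimal.lintegral_excess_le`). The tail beyond radius `r` scales like `r ^ (-s)`, so for `Θ`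
large in terms of `s` the collar outweighs the far region at every `x ∈ Ω`, and the excess vanishes
a.e. (`IsSMinimal.ae_le`). The infimum follows by passing to `-u`. -/

/-- The integral of the kernel `‖z‖ ^ (-(n + s))` over the complement of the ball of radius `r`. -/
noncomputable def kernelTail (n : ℕ) (s r : ℝ) : ℝ≥0∞ :=
  ∫⁻ z in {z : EuclideanSpace ℝ (Fin n) | r ≤ ‖z‖}, ENNReal.ofReal (1 / ‖z‖ ^ ((n : ℝ) + s))

theorem measurableSet_le_norm (n : ℕ) (r : ℝ) :
    MeasurableSet {z : EuclideanSpace ℝ (Fin n) | r ≤ ‖z‖} :=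
  measurableSet_le measurable_const measurable_norm

/-- Substituting `z ↦ r • z`, the Jacobian `r ^ n` meets the factor `r ^ (-(n + s))` from the
kernel. -/
theorem kernelTail_eq_mul {n : ℕ} {s r : ℝ} (hr : 0 < r) :
    kernelTail n s r = ENNReal.ofReal (r ^ (-s)) * kernelTail n s 1 := by
  have hm (t : ℝ) := measurableSet_le_norm n t
  set K : EuclideanSpace ℝ (Fin n) → ℝ≥0∞ := fun z => ENNReal.ofReal (1 / ‖z‖ ^ ((n : ℝ) + s))
    with hK
  have hKm : Measurable K := by fun_prop
  have hscale (z : EuclideanSpace ℝ (Fin n)) :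
      {z : EuclideanSpace ℝ (Fin n) | r ≤ ‖z‖}.indicator K (r • z) =
        ENNReal.ofReal (r ^ (-((n : ℝ) + s))) *
          {z : EuclideanSpace ℝ (Fin n) | 1 ≤ ‖z‖}.indicator K z := by
    have hn : ‖r • z‖ = r * ‖z‖ := by rw [norm_smul, Real.norm_of_nonneg hr.le]
    have hiff : r ≤ r * ‖z‖ ↔ 1 ≤ ‖z‖ := by
      constructor <;> intro h <;> nlinarith
    by_cases h : 1 ≤ ‖z‖
    · rw [indicator_of_mem (by simpa [hn] using hiff.2 h), indicator_of_mem (by simpa using h),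
        hK]
      simp only
      rw [← ENNReal.ofReal_mul (by positivity), hn, Real.mul_rpow hr.le (norm_nonneg z),
        Real.rpow_neg hr.le]
      congr 1
      field_simp
    · rw [indicator_of_notMem (by simpa [hn] using fun h' => h (hiff.1 h')),
        indicator_of_notMem (by simpa using h), mul_zero]
  have hmap := Measure.map_addHaar_smul
    (volume : Measure (EuclideanSpace ℝ (Fin n))) hr.ne'
  have key : ENNReal.ofReal (|(r ^ n)⁻¹|) * kernelTail n s r =
      ENNReal.ofReal (r ^ (-((n : ℝ) + s))) * kernelTail n s 1 := by
    have h1 := lintegral_map (μ := volume) (hKm.indicator (hm r)) (measurable_const_smul r)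
    rw [hmap, lintegral_smul_measure, lintegral_indicator (hm r)] at h1
    simp_rw [hscale] at h1
    rw [lintegral_const_mul _ (hKm.indicator (hm 1)), lintegral_indicator (hm 1)] at h1
    simpa [kernelTail, hK] using h1
  have hrn : ENNReal.ofReal (r ^ n) * ENNReal.ofReal (|(r ^ n)⁻¹|) = 1 := by
    rw [← ENNReal.ofReal_mul (by positivity), abs_of_pos (by positivity),
      mul_inv_cancel₀ (by positivity), ENNReal.ofReal_one]
  rw [← one_mul (kernelTail n s r), ← hrn, mul_assoc, key, ← mul_assoc,
    ← ENNReal.ofReal_mul (by positivity), ← Real.rpow_natCast, ← Real.rpow_add hr]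
  congr 3
  ring

theorem kernelTail_one_ne_top {n : ℕ} {s : ℝ} (hs : 0 < s) : kernelTail n s 1 ≠ ∞ := by
  have h := finite_integral_one_add_norm (E := EuclideanSpace ℝ (Fin n)) (μ := volume)
    (r := (n : ℝ) + s) (by simpa using hs)
  refine ne_of_lt (lt_of_le_of_lt ?_
    (ENNReal.mul_lt_top (ENNReal.ofReal_lt_top (r := 2 ^ ((n : ℝ) + s))) h))
  rw [← lintegral_const_mul _ (by fun_prop)]
  refine (setLIntegral_mono' (measurableSet_le_norm n 1) fun z hz => ?_).trans
    (setLIntegral_le_lintegral _ _)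
  have hz : 1 ≤ ‖z‖ := hz
  rw [← ENNReal.ofReal_mul (by positivity)]
  refine ENNReal.ofReal_le_ofReal ?_
  rw [Real.rpow_neg (by positivity), ← div_eq_mul_inv, div_le_div_iff₀ (by positivity)
    (by positivity), one_mul, ← Real.mul_rpow (by norm_num) (by positivity)]
  exact Real.rpow_le_rpow (by positivity) (by linarith) (by positivity)

theorem kernelTail_one_ne_zero {n : ℕ} (hn : 1 ≤ n) (s : ℝ) : kernelTail n s 1 ≠ 0 := by
  intro h
  rw [kernelTail, setLIntegral_eq_zero_iff (measurableSet_le_norm n 1) (by fun_prop)] at h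
  have : Nonempty (Fin n) := ⟨⟨0, hn⟩⟩
  obtain ⟨e, he⟩ := exists_norm_eq (EuclideanSpace ℝ (Fin n)) (c := 2) (by norm_num)
  have hU : IsOpen {z : EuclideanSpace ℝ (Fin n) | 1 < ‖z‖} :=
    isOpen_lt continuous_const continuous_norm
  refine (hU.measure_pos volume ⟨e, by simp [he]⟩).ne'
    (measure_mono_null (fun z hz => ?_) h)
  have hz : 1 < ‖z‖ := hz
  intro h0
  have h1 := h0 hz.le
  rw [ENNReal.ofReal_eq_zero] at h1
  exact absurd h1 (not_le.2 (by positivity))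

/-- A dilation by a large factor, depending on `n` and `s` only, makes the tail less than half. -/
theorem exists_two_mul_kernelTail_lt {n : ℕ} (hn : 1 ≤ n) {s : ℝ} (hs : 0 < s) :
    ∃ Θ : ℝ, 1 < Θ ∧ ∀ d : ℝ, 0 < d → 2 * kernelTail n s (Θ * d) < kernelTail n s (2 * d) := by
  have h3 : (1 : ℝ) < 3 ^ (1 / s) := Real.one_lt_rpow (by norm_num) (by positivity)
  -- Since `(3 ^ (1 / s)) ^ (-s) = 1 / 3`, the tail at `Θ * d` is a third of the tail at `2 * d`,
  -- and `2 / 3 < 1`.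
  refine ⟨2 * 3 ^ (1 / s), by linarith, fun d hd => ?_⟩
  rw [kernelTail_eq_mul (by positivity : 0 < 2 * 3 ^ (1 / s) * d),
    kernelTail_eq_mul (by positivity : 0 < 2 * d), ← mul_assoc]
  refine ENNReal.mul_lt_mul_left (kernelTail_one_ne_zero hn s) (kernelTail_one_ne_top hs) ?_
  have h : (2 * 3 ^ (1 / s) * d : ℝ) ^ (-s) = (2 * d) ^ (-s) / 3 := by
    rw [show (2 * 3 ^ (1 / s) * d : ℝ) = (2 * d) * 3 ^ (1 / s) by ring,
      Real.mul_rpow (by positivity) (by positivity), ← Real.rpow_mul (by norm_num),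
      show 1 / s * -s = -1 by field_simp, Real.rpow_neg_one]
    ring
  have hp : (0 : ℝ) < (2 * d) ^ (-s) := by positivity
  rw [h, show (2 : ℝ≥0∞) = ENNReal.ofReal 2 by simp, ← ENNReal.ofReal_mul (by norm_num)]
  exact (ENNReal.ofReal_lt_ofReal_iff hp).2 (by linarith)

theorem setLIntegral_kernel_le_norm_sub {n : ℕ} (s r : ℝ) (x : EuclideanSpace ℝ (Fin n)) :
    ∫⁻ y in {y | r ≤ ‖x - y‖}, ENNReal.ofReal (1 / ‖x - y‖ ^ ((n : ℝ) + s)) =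
      kernelTail n s r := by
  have hm := measurableSet_le_norm n r
  have hm' : MeasurableSet {y : EuclideanSpace ℝ (Fin n) | r ≤ ‖x - y‖} :=
    measurableSet_le measurable_const (by fun_prop)
  rw [kernelTail, ← lintegral_indicator hm, ← lintegral_indicator hm']
  exact lintegral_sub_left_eq_self
    ({z : EuclideanSpace ℝ (Fin n) | r ≤ ‖z‖}.indicator
      fun z => ENNReal.ofReal (1 / ‖z‖ ^ ((n : ℝ) + s))) x

/-! ### Energy comparison with the truncation -/

theorem abs_sub_sub_abs_min_sub {a b M : ℝ} (hb : b ≤ M) :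
    |a - b| - |min a M - b| = max (a - M) 0 := by
  rcases le_total a M with h | h
  · rw [min_eq_left h, max_eq_right (by linarith), sub_self]
  · rw [min_eq_right h, max_eq_left (by linarith), abs_of_nonneg (by linarith),
      abs_of_nonneg (by linarith)]
    ring

theorem abs_min_sub_sub_abs_sub_le (a b M : ℝ) :
    |min a M - b| - |a - b| ≤ max (a - M) 0 := by
  rcases le_total a M with h | h
  · rw [min_eq_left h, max_eq_right (by linarith), sub_self]
  · rw [min_eq_right h, max_eq_left (by linarith)]
    calc |M - b| - |a - b| ≤ |(M - b) - (a - b)| := abs_sub_abs_le_abs_sub _ _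
      _ = a - M := by rw [abs_of_nonpos (by linarith)]; ring

theorem abs_min_sub_min_le_abs_sub (a b M : ℝ) : |min a M - min b M| ≤ |a - b| := by
  simpa using abs_min_sub_min_le_max a M b M

/-- Truncating at height `M` inside `Ω` gives an admissible competitor. -/
theorem piecewise_min_mem_fracSobolevSpace {n : ℕ} {s : ℝ} {Ω : Set (EuclideanSpace ℝ (Fin n))}
    [∀ x, Decidable (x ∈ Ω)] (hΩ : MeasurableSet Ω) (hfin : volume Ω ≠ ∞)
    {u : EuclideanSpace ℝ (Fin n) → ℝ} (hu : u ∈ fracSobolevSpace s Ω) (M : ℝ) :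
    Ω.piecewise (fun x => min (u x) M) u ∈ fracSobolevSpace s Ω := by
  obtain ⟨hum, hui, hus⟩ := hu
  refine ⟨?_, ?_, lt_of_le_of_lt ?_ hus⟩
  · rw [← indicator_add_compl_eq_piecewise]
    exact ((hum.min aemeasurable_const).indicator hΩ).add (hum.indicator hΩ.compl)
  · have h : IntegrableOn (fun x => min (u x) M) Ω volume :=
      Integrable.inf hui (integrableOn_const hfin)
    exact h.congr_fun (fun x hx => (piecewise_eq_of_mem Ω (fun x => min (u x) M) u hx).symm) hΩ
  · refine setLIntegral_mono' hΩ fun x hx => setLIntegral_mono' hΩ fun y hy => ?_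
    rw [piecewise_eq_of_mem _ _ _ hx, piecewise_eq_of_mem _ _ _ hy]
    refine ENNReal.ofReal_le_ofReal ?_
    exact div_le_div_of_nonneg_right (abs_min_sub_min_le_abs_sub _ _ _) (by positivity)

/-- Lets the two halves `Ω × 𝒞Ω` and `𝒞Ω × Ω` of the interaction region be treated as one. -/
theorem lintegral_add_comp_swap {α : Type*} [MeasurableSpace α] {μ : Measure α} [SFinite μ]
    {G : α × α → ℝ≥0∞} (hG : AEMeasurable G (μ.prod μ)) :
    ∫⁻ z, (G z + G z.swap) ∂μ.prod μ = 2 * ∫⁻ z, G z ∂μ.prod μ := by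
  rw [lintegral_add_left' hG, lintegral_prod_swap, two_mul]

theorem lintegral_indicator_prod_mul {α : Type*} [MeasurableSpace α] {μ : Measure α} [SFinite μ]
    {S T : Set α} (hS : MeasurableSet S) (hT : MeasurableSet T) {w : α → ℝ≥0∞}
    (hw : AEMeasurable w μ) {k : α × α → ℝ≥0∞} (hk : Measurable k) :
    ∫⁻ z, (S ×ˢ T).indicator (fun z => w z.1 * k z) z ∂μ.prod μ =
      ∫⁻ x in S, w x * ∫⁻ y in T, k (x, y) ∂μ ∂μ := by
  have hm : AEMeasurable (fun z : α × α => w z.1 * k z) (μ.prod μ) :=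
    (hw.comp_quasiMeasurePreserving Measure.quasiMeasurePreserving_fst).mul hk.aemeasurable
  have hm' := hm.restrict (s := S ×ˢ T)
  rw [lintegral_indicator (hS.prod hT), ← Measure.prod_restrict]
  rw [← Measure.prod_restrict] at hm'
  rw [lintegral_prod _ hm']
  refine lintegral_congr fun x => ?_
  exact lintegral_const_mul (w x) (hk.comp (measurable_prodMk_left (x := x)))

/-- The comparison of a minimal function with its truncation: the excess of `u` over `M`, weighted
with its interaction with `A`, where `u ≤ M`, is at most the excess weighted with its interaction
with the complement of `Ω ∪ A`. -/
theorem IsSMinimal.lintegral_excess_le {n : ℕ} {s : ℝ} {Ω A : Set (EuclideanSpace ℝ (Fin n))}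
    (hΩ : MeasurableSet Ω) (hfin : volume Ω ≠ ∞) (hA : MeasurableSet A) (hdisj : Disjoint Ω A)
    {u : EuclideanSpace ℝ (Fin n) → ℝ} (hu : IsSMinimal s Ω u) {M : ℝ}
    (hM : ∀ᵐ x ∂volume.restrict A, u x ≤ M) :
    ∫⁻ x in Ω, ENNReal.ofReal (u x - M) *
        ∫⁻ y in A, ENNReal.ofReal (1 / ‖x - y‖ ^ ((n : ℝ) + s)) ≤
      ∫⁻ x in Ω, ENNReal.ofReal (u x - M) *
        ∫⁻ y in (Ω ∪ A)ᶜ, ENNReal.ofReal (1 / ‖x - y‖ ^ ((n : ℝ) + s)) := by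
  classical
  set w : EuclideanSpace ℝ (Fin n) → ℝ≥0∞ := fun x => ENNReal.ofReal (u x - M) with hw
  set k : EuclideanSpace ℝ (Fin n) × EuclideanSpace ℝ (Fin n) → ℝ≥0∞ :=
    fun z => ENNReal.ofReal (1 / ‖z.1 - z.2‖ ^ ((n : ℝ) + s)) with hk
  have hwm : AEMeasurable w volume := (hu.1.1.sub_const M).ennreal_ofReal
  have hkm : Measurable k := by fun_prop
  set v := Ω.piecewise (fun x => min (u x) M) u with hv
  have hvin {x} (hx : x ∈ Ω) : v x = min (u x) M := piecewise_eq_of_mem _ _ _ hx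
  have hvout {x} (hx : x ∉ Ω) : v x = u x := piecewise_eq_of_notMem _ _ _ hx
  have hmin := hu.2 v (piecewise_min_mem_fracSobolevSpace hΩ hfin hu.1 M)
    (by filter_upwards [ae_restrict_mem hΩ.compl] with x hx using (hvout hx).symm)
  have hQ : MeasurableSet (interactionRegion Ω) := (hΩ.compl.prod hΩ.compl).compl
  rw [HasNonposIntegral, ← lintegral_indicator hQ, ← lintegral_indicator hQ,
    Measure.volume_eq_prod] at hmin
  set f : EuclideanSpace ℝ (Fin n) × EuclideanSpace ℝ (Fin n) → ℝ := fun z =>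
    (|u z.1 - u z.2| - |v z.1 - v z.2|) / ‖z.1 - z.2‖ ^ ((n : ℝ) + s) with hf
  have hfs (z) : f z.swap = f z := by
    simp only [hf, Prod.fst_swap, Prod.snd_swap, norm_sub_rev z.2 z.1, abs_sub_comm (u z.2),
      abs_sub_comm (v z.2)]
  have hmul (a : ℝ) (z : EuclideanSpace ℝ (Fin n) × EuclideanSpace ℝ (Fin n)) :
      ENNReal.ofReal (max (a - M) 0 / ‖z.1 - z.2‖ ^ ((n : ℝ) + s)) =
        ENNReal.ofReal (a - M) * k z := by
    rw [hk, div_eq_mul_one_div, ENNReal.ofReal_mul (le_max_right _ _), ENNReal.ofReal_max,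
      ENNReal.ofReal_zero, max_eq_left (zero_le)]
  set G := (Ω ×ˢ A).indicator fun z => w z.1 * k z with hG
  set H := (Ω ×ˢ (Ω ∪ A)ᶜ).indicator fun z => w z.1 * k z with hH
  have hwk : AEMeasurable
      (fun z : EuclideanSpace ℝ (Fin n) × EuclideanSpace ℝ (Fin n) => w z.1 * k z)
      (volume.prod volume) :=
    (hwm.comp_quasiMeasurePreserving Measure.quasiMeasurePreserving_fst).mul hkm.aemeasurable
  have hGm : AEMeasurable G (volume.prod volume) := hwk.indicator (hΩ.prod hA)
  have hHm : AEMeasurable H (volume.prod volume) :=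
    hwk.indicator (hΩ.prod (hΩ.union hA).compl)
  -- the pointwise bounds, for a first coordinate in `Ω`
  have hGle (z : EuclideanSpace ℝ (Fin n) × EuclideanSpace ℝ (Fin n)) (h1 : z.1 ∈ Ω)
      (h2 : z.2 ∈ A → u z.2 ≤ M) (h3 : z.2 ∈ A) : ENNReal.ofReal (f z) = w z.1 * k z := by
    rw [hf]
    simp only
    rw [hvin h1, hvout (fun h => disjoint_left.1 hdisj h h3), abs_sub_sub_abs_min_sub (h2 h3),
      hmul]
  have hHle (z : EuclideanSpace ℝ (Fin n) × EuclideanSpace ℝ (Fin n)) (h1 : z.1 ∈ Ω)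
      (h2 : z.2 ∈ A → u z.2 ≤ M) : ENNReal.ofReal (-f z) ≤ H z := by
    by_cases h3 : z.2 ∈ Ω
    · refine le_of_eq_of_le (ENNReal.ofReal_of_nonpos (neg_nonpos.2 ?_)) (zero_le)
      simp only [hf]
      rw [hvin h1, hvin h3]
      exact div_nonneg (sub_nonneg.2 (abs_min_sub_min_le_abs_sub _ _ _)) (by positivity)
    by_cases h4 : z.2 ∈ A
    · refine le_of_eq_of_le (ENNReal.ofReal_of_nonpos (neg_nonpos.2 ?_)) (zero_le)
      simp only [hf]
      rw [hvin h1, hvout h3, abs_sub_sub_abs_min_sub (h2 h4)]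
      positivity
    · rw [hH, indicator_of_mem (show z ∈ Ω ×ˢ (Ω ∪ A)ᶜ from ⟨h1, by simp [h3, h4]⟩), hw]
      simp only
      rw [← hmul, hf]
      simp only
      rw [hvin h1, hvout h3, ← neg_div, neg_sub]
      refine ENNReal.ofReal_le_ofReal ?_
      exact div_le_div_of_nonneg_right (abs_min_sub_sub_abs_sub_le _ _ _) (by positivity)
  have hae := (ae_restrict_iff' hA).1 hM
  have hae1 : ∀ᵐ z ∂(volume : Measure (EuclideanSpace ℝ (Fin n))).prod
      (volume : Measure (EuclideanSpace ℝ (Fin n))), z.1 ∈ A → u z.1 ≤ M :=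
    Measure.quasiMeasurePreserving_fst.ae hae
  have hae2 : ∀ᵐ z ∂(volume : Measure (EuclideanSpace ℝ (Fin n))).prod
      (volume : Measure (EuclideanSpace ℝ (Fin n))), z.2 ∈ A → u z.2 ≤ M :=
    Measure.quasiMeasurePreserving_snd.ae hae
  -- Bounding `f⁺` below and `f⁻` above separately lets minimality be used without integrability of
  -- `f`. Since `Ω` and `A` are disjoint, at most one of `G z`, `G z.swap` is nonzero.
  have hlow : ∀ᵐ z ∂(volume : Measure (EuclideanSpace ℝ (Fin n))).prod volume,
      G z + G z.swap ≤ (interactionRegion Ω).indicator (fun z => ENNReal.ofReal (f z)) z := by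
    filter_upwards [hae1, hae2] with z hz1 hz2
    by_cases h1 : z ∈ Ω ×ˢ A
    · have h2 : z.swap ∉ Ω ×ˢ A := fun h => disjoint_left.1 hdisj h1.1 h.2
      have h3 : z ∈ interactionRegion Ω := fun h => h.1 h1.1
      rw [hG, indicator_of_mem h1, indicator_of_notMem h2, indicator_of_mem h3, add_zero,
        hGle z h1.1 hz2 h1.2]
    · by_cases h2 : z.swap ∈ Ω ×ˢ A
      · have h3 : z ∈ interactionRegion Ω := fun h => h.2 h2.1
        rw [hG, indicator_of_notMem h1, indicator_of_mem h2, indicator_of_mem h3, zero_add,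
          ← hGle z.swap h2.1 hz1 h2.2, hfs]
      · rw [hG, indicator_of_notMem h1, indicator_of_notMem h2, zero_add]
        exact zero_le
  have hup : ∀ᵐ z ∂(volume : Measure (EuclideanSpace ℝ (Fin n))).prod volume,
      (interactionRegion Ω).indicator (fun z => ENNReal.ofReal (-f z)) z ≤ H z + H z.swap := by
    filter_upwards [hae1, hae2] with z hz1 hz2
    by_cases h1 : z.1 ∈ Ω
    · exact (indicator_le_self' (fun _ _ => zero_le) z).trans
        ((hHle z h1 hz2).trans le_self_add)
    · by_cases h2 : z.2 ∈ Ω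
      · have := hHle z.swap h2 hz1
        rw [hfs] at this
        exact (indicator_le_self' (fun _ _ => zero_le) z).trans (this.trans le_add_self)
      · rw [indicator_of_notMem (show z ∉ interactionRegion Ω from fun h => h ⟨h1, h2⟩)]
        exact zero_le
  have h := (lintegral_mono_ae hlow).trans (hmin.trans (lintegral_mono_ae hup))
  rw [lintegral_add_comp_swap hGm, lintegral_add_comp_swap hHm,
    ENNReal.mul_le_mul_iff_right (by norm_num) (by norm_num), hG, hH,
    lintegral_indicator_prod_mul hΩ hA hwm hkm,
    lintegral_indicator_prod_mul hΩ (hΩ.union hA).compl hwm hkm] at h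
  exact h

/-! ### The maximum principle -/

theorem IsSMinimal.neg {n : ℕ} {s : ℝ} {Ω : Set (EuclideanSpace ℝ (Fin n))}
    {u : EuclideanSpace ℝ (Fin n) → ℝ} (hu : IsSMinimal s Ω u) : IsSMinimal s Ω (-u) := by
  have habs (w : EuclideanSpace ℝ (Fin n) → ℝ) (x y) : |(-w) x - (-w) y| = |w x - w y| := by
    rw [Pi.neg_apply, Pi.neg_apply, neg_sub_neg, abs_sub_comm]
  have hmem {w : EuclideanSpace ℝ (Fin n) → ℝ} (hw : w ∈ fracSobolevSpace s Ω) :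
      -w ∈ fracSobolevSpace s Ω := by
    refine ⟨hw.1.neg, hw.2.1.neg, ?_⟩
    simpa only [gagliardoSeminorm, habs] using hw.2.2
  refine ⟨hmem hu.1, fun v hv huv => ?_⟩
  have h := hu.2 (-v) (hmem hv) (by
    filter_upwards [huv] with x hx
    rw [Pi.neg_apply, ← hx, Pi.neg_apply, neg_neg])
  simpa only [habs] using h

theorem IsSMinimal.ae_le {n : ℕ} {s : ℝ} {Ω : Set (EuclideanSpace ℝ (Fin n))}
    (hΩ : IsOpen Ω) (hb : Bornology.IsBounded Ω) {Θ : ℝ} (hΘ : 0 < Θ)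
    (hd : 0 < Metric.diam Ω)
    (htail : 2 * kernelTail n s (Θ * Metric.diam Ω) < kernelTail n s (2 * Metric.diam Ω))
    {u : EuclideanSpace ℝ (Fin n) → ℝ} (hu : IsSMinimal s Ω u) {M : ℝ}
    (hM : ∀ᵐ x ∂volume.restrict (Metric.thickening (Θ * Metric.diam Ω) Ω \ Ω), u x ≤ M) :
    ∀ᵐ x ∂volume.restrict Ω, u x ≤ M := by
  set d := Metric.diam Ω
  have hr : 0 < Θ * d := by positivity
  set A := Metric.thickening (Θ * d) Ω \ Ω with hA
  have hAm : MeasurableSet A := Metric.isOpen_thickening.measurableSet.diff hΩ.measurableSet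
  have hfin : volume Ω ≠ ∞ := hb.measure_lt_top.ne
  have key := hu.lintegral_excess_le hΩ.measurableSet hfin hAm disjoint_sdiff_right hM
  have hunion : Ω ∪ A = Metric.thickening (Θ * d) Ω :=
    union_sdiff_cancel (Metric.self_subset_thickening hr Ω)
  rw [hunion] at key
  have hfar {x} (hx : x ∈ Ω) :
      ∫⁻ y in (Metric.thickening (Θ * d) Ω)ᶜ, ENNReal.ofReal (1 / ‖x - y‖ ^ ((n : ℝ) + s)) ≤
        kernelTail n s (Θ * d) := by
    rw [← setLIntegral_kernel_le_norm_sub s _ x]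
    refine lintegral_mono_set fun y hy => ?_
    by_contra h
    exact hy (Metric.mem_thickening_iff.2 ⟨x, hx, by
      rw [dist_comm, dist_eq_norm]
      exact not_le.1 h⟩)
  -- A point at distance at least `2 * d > d` from `x ∈ Ω` is outside `Ω`, so it lies in the collar
  -- or beyond it.
  have hnear {x} (hx : x ∈ Ω) : kernelTail n s (2 * d) - kernelTail n s (Θ * d) ≤
      ∫⁻ y in A, ENNReal.ofReal (1 / ‖x - y‖ ^ ((n : ℝ) + s)) := by
    rw [tsub_le_iff_right]
    refine le_trans ?_ (add_le_add_right (hfar hx) _)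
    rw [← setLIntegral_kernel_le_norm_sub s (2 * d) x]
    refine (lintegral_mono_set fun y hy => ?_).trans (lintegral_union_le _ _ _)
    have hyΩ : y ∉ Ω := fun h => by
      have h1 : 2 * d ≤ ‖x - y‖ := hy
      have h2 := Metric.dist_le_diam_of_mem hb hx h
      rw [dist_eq_norm] at h2
      linarith
    by_cases h : y ∈ Metric.thickening (Θ * d) Ω
    · exact Or.inl ⟨h, hyΩ⟩
    · exact Or.inr h
  have hwm : AEMeasurable (fun x => ENNReal.ofReal (u x - M)) (volume.restrict Ω) :=
    (hu.1.1.restrict.sub_const M).ennreal_ofReal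
  -- Finiteness, from `u ∈ L¹(Ω)` and `|Ω| < ∞`, is what allows the total excess to be cancelled
  -- below.
  have hW : ∫⁻ x in Ω, ENNReal.ofReal (u x - M) ≠ ∞ :=
    (Integrable.lintegral_lt_top (Integrable.sub hu.1.2.1 (integrableOn_const hfin))).ne
  have hle : (∫⁻ x in Ω, ENNReal.ofReal (u x - M)) *
      (kernelTail n s (2 * d) - kernelTail n s (Θ * d)) ≤
        (∫⁻ x in Ω, ENNReal.ofReal (u x - M)) * kernelTail n s (Θ * d) := by
    rw [← lintegral_mul_const'' _ hwm, ← lintegral_mul_const'' _ hwm]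
    refine (setLIntegral_mono' hΩ.measurableSet fun x hx => ?_).trans
      (key.trans (setLIntegral_mono' hΩ.measurableSet fun x hx => ?_))
    · gcongr
      exact hnear hx
    · gcongr
      exact hfar hx
  have hW0 : ∫⁻ x in Ω, ENNReal.ofReal (u x - M) = 0 := by
    by_contra h0
    rw [ENNReal.mul_le_mul_iff_right h0 hW, tsub_le_iff_right, ← two_mul] at hle
    exact not_lt.2 hle htail
  rw [lintegral_eq_zero_iff' hwm] at hW0
  filter_upwards [hW0] with x hx
  exact sub_nonpos.1 (ENNReal.ofReal_eq_zero.1 hx)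

theorem mainTheorem7 (n : ℕ) (hn : 1 ≤ n) (s : ℝ) (hs0 : 0 < s) (hs1 : s < 1) :
    ∃ Θ : ℝ, 1 < Θ ∧
      ∀ Ω : Set (EuclideanSpace ℝ (Fin n)),
        IsOpen Ω → Bornology.IsBounded Ω → HasLipschitzBoundary Ω →
        ∀ u : EuclideanSpace ℝ (Fin n) → ℝ, IsSMinimal s Ω u →
          essSup (fun x => (u x : EReal)) (volume.restrict Ω) ≤
              essSup (fun x => (u x : EReal))
                (volume.restrict (Metric.thickening (Θ * Metric.diam Ω) Ω \ Ω)) ∧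
            essInf (fun x => (u x : EReal))
                (volume.restrict (Metric.thickening (Θ * Metric.diam Ω) Ω \ Ω)) ≤
              essInf (fun x => (u x : EReal)) (volume.restrict Ω) := by
  obtain ⟨Θ, hΘ, htail⟩ := exists_two_mul_kernelTail_lt hn hs0
  refine ⟨Θ, hΘ, fun Ω hΩ hb _ u hu => ?_⟩
  rcases Ω.eq_empty_or_nonempty with rfl | ⟨p, hp⟩
  · simp
  have : Nonempty (Fin n) := ⟨⟨0, hn⟩⟩
  -- In dimension at least one, a nonempty open set is infinite.
  have hd : 0 < Metric.diam Ω :=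
    Metric.diam_pos (infinite_of_mem_nhds p (hΩ.mem_nhds hp)).nontrivial hb
  constructor
  · by_contra! h
    -- A real level strictly between the two suprema also covers infinite values.
    obtain ⟨M, hM1, hM2⟩ := EReal.lt_iff_exists_real_btwn.1 h
    have hle := hu.ae_le hΩ hb (by linarith) hd (htail _ hd) (M := M) (by
      filter_upwards [ae_lt_of_essSup_lt hM1] with x hx using EReal.coe_le_coe_iff.1 hx.le)
    refine not_le.2 hM2 (essSup_le_of_ae_le _ ?_)
    filter_upwards [hle] with x hx using EReal.coe_le_coe_iff.2 hx
  · by_contra! h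
    obtain ⟨M, hM1, hM2⟩ := EReal.lt_iff_exists_real_btwn.1 h
    have hle := hu.neg.ae_le hΩ hb (by linarith) hd (htail _ hd) (M := -M) (by
      filter_upwards [ae_lt_of_lt_essInf hM2] with x hx
        using neg_le_neg (EReal.coe_le_coe_iff.1 hx.le))
    refine not_le.2 hM1 (le_essInf_of_ae_le _ ?_)
    filter_upwards [hle] with x hx using EReal.coe_le_coe_iff.2 (neg_le_neg_iff.1 hx)
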